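/- **Setting.** Let $\eta,d$ be natural numbers. An *oracle family* is $\mathcal Q=(Q_1,\dots,Q_\eta)$, where each $Q_j$ is a $d\times d$ unitary matrix all of whose eigenvalues lie in $\{1,-1\}$; for real $\alpha$ let $Q_j^{\alpha}=\tfrac12(\mathbb 1+Q_j)+e^{-i\pi\alpha}\,\tfrac12(\mathbb 1-Q_j)$. A *fractional-query algorithm* with cost $T$ consists of unitaries $U_0,\dots,U_\lambda$ on $\mathbb C^d$, indices $i_1,\dots,i_\lambda\in\{1,\dots,\eta\}$ and exponents $0<\alpha_k\le 1$ with $\sum_{k=1}^\lambda\alpha_k=T$, all independent of the oracles. Run on $\mathcal Q$ it performs $$U(\mathcal Q)=U_\lambda\,Q_{i_\lambda}^{\alpha_\lambda}\,U_{\lambda-1}\cdots U_1\,Q_{i_1}^{\alpha_1}\,U_0 .$$ Let $Q=\sum_{j=1}^{\eta}|j\rangle\langle j|\otimes Q_j$ on $\mathbb C^\eta\otimes\mathbb C^d$. A *circuit making $k$ queries to $Q$* acts on $\mathcal W\otimes\mathbb C^2\otimes\mathbb C^\eta\otimes\mathbb C^d$, where $\mathcal W$ is a finite-dimensional work space, and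 is a product $W_k\hat QW_{k-1}\cdots W_1\hat QW_0$, where the unitaries $W_0,\dots,W_k$ are independent of the oracles and $\hat Q=\mathbb 1_{\mathcal W}\otimes\bigl(|0\rangle\langle0|\otimes\mathbb 1+|1\rangle\langle1|\otimes Q\bigr)$ is the controlled query to $Q$. It *implements* a unitary $U$ on $\mathbb C^d$ *with error at most $\epsilon$* if, for a fixed computational basis state $|\mathrm{init}\rangle$ of $\mathcal W\otimes\mathbb C^2\otimes\mathbb C^\eta$ independent of the oracles, it maps $|\mathrm{init}\rangle|\psi\rangle$ to a vector within Euclidean distance $\epsilon$ of $|\mathrm{init}\rangle U|\psi\rangle$, for every unit vector $|\psi\rangle\in\mathbb C^d$. **Theorem (Multiple-query model).** There is an absolute constant $K>0$ such that for all $\eta,d$, every fractional-query algorithm over $\eta$ oracles on $\mathbb C^d$ with cost $T\ge 1$, and every $\epsilon>0$ with $T/\epsilon>e$, there is a circuit that makes at most $$K\,T\,\frac{\log(T/\epsilon)}{\log\log(T/\epsilon)}$$ queries to $Q$ and that, for every oracle family $\mathcal Q=(Q_1,\dots,Q_\eta)$ of $d\times d$ unitaries with eigenvalues $\pm1$, implements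 $U(\mathcal Q)$ with error at most $\epsilon$. -/

import Mathlib

open scoped Kronecker

noncomputable section

/-- The oracles of the model: unitary matrices all of whose eigenvalues are `1` or `-1`. -/
def IsSignOracle {d : ℕ} (Q : Matrix (Fin d) (Fin d) ℂ) : Prop :=
  Q ∈ Matrix.unitaryGroup (Fin d) ℂ ∧ spectrum ℂ Q ⊆ {1, -1}

/-- The fractional power `Q ^ α = (1 + Q) / 2 + e ^ (-iπα) (1 - Q) / 2` of a unitary `Q` with
eigenvalues `±1`: it is `1` on the eigenspace of `1` and `e ^ (-iπα)` on that of `-1`. -/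
def fractionalPower {d : ℕ} (Q : Matrix (Fin d) (Fin d) ℂ) (α : ℝ) : Matrix (Fin d) (Fin d) ℂ :=
  (1 / 2 : ℂ) • (1 + Q) + (Complex.exp (-Complex.I * Real.pi * α) / 2) • (1 - Q)

/-- One step of a fractional-query algorithm: a fractional query `Q_i ^ α` with `0 < α ≤ 1`,
followed by a unitary that does not depend on the oracles. -/
structure FractionalStep (η d : ℕ) where
  exponent : ℝ
  exponent_pos : 0 < exponent
  exponent_le_one : exponent ≤ 1
  oracle : Fin η
  gate : Matrix.unitaryGroup (Fin d) ℂ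

/-- A fractional-query algorithm `U_l Q_{i_l}^{α_l} U_{l-1} ⋯ U_1 Q_{i_1}^{α_1} U_0` over `η`
oracles on `ℂ^d`: the unitary `U_0` and the list of the steps `(α_k, i_k, U_k)`, `k = 1, …, l`,
in the order in which they are applied. -/
structure FractionalQueryAlgorithm (η d : ℕ) where
  first : Matrix.unitaryGroup (Fin d) ℂ
  steps : List (FractionalStep η d)

/-- The cost `α_1 + ⋯ + α_l`. -/
def FractionalQueryAlgorithm.cost {η d : ℕ} (A : FractionalQueryAlgorithm η d) : ℝ :=
  (A.steps.map FractionalStep.exponent).sum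

/-- The operation `U_l Q_{i_l}^{α_l} U_{l-1} ⋯ U_1 Q_{i_1}^{α_1} U_0` that the algorithm performs
when it is run with the oracles `Q_1, …, Q_η`. -/
def FractionalQueryAlgorithm.eval {η d : ℕ} (A : FractionalQueryAlgorithm η d)
    (Q : Fin η → Matrix (Fin d) (Fin d) ℂ) : Matrix (Fin d) (Fin d) ℂ :=
  A.steps.foldl (fun M s => s.gate.1 * fractionalPower (Q s.oracle) s.exponent * M) A.first.1

/-- The oracle `Q = ∑_j |j⟩⟨j| ⊗ Q_j` on `ℂ^η ⊗ ℂ^d`. -/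
def jointOracle {η d : ℕ} (Q : Fin η → Matrix (Fin d) (Fin d) ℂ) :
    Matrix (Fin η × Fin d) (Fin η × Fin d) ℂ :=
  ∑ j : Fin η, Matrix.single j j (1 : ℂ) ⊗ₖ Q j

/-- The computational basis of the space on which a query circuit acts: a work register, the
control qubit of the query gate, the index register, and the target system. -/
abbrev Register (Work : Type) (η d : ℕ) : Type := Work × (Fin 2 × (Fin η × Fin d))

/-- The query gate: one application of `Q = ∑_j |j⟩⟨j| ⊗ Q_j`, controlled by a qubit, that is
`|0⟩⟨0| ⊗ 1 + |1⟩⟨1| ⊗ Q`, with the identity on the work register. An uncontrolled query is the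
special case in which the control qubit is in the state `|1⟩`. -/
def queryGate (Work : Type) [Fintype Work] [DecidableEq Work] {η d : ℕ}
    (Q : Fin η → Matrix (Fin d) (Fin d) ℂ) :
    Matrix (Register Work η d) (Register Work η d) ℂ :=
  (1 : Matrix Work Work ℂ) ⊗ₖ
    (Matrix.single (0 : Fin 2) 0 (1 : ℂ) ⊗ₖ (1 : Matrix (Fin η × Fin d) (Fin η × Fin d) ℂ) +
      Matrix.single (1 : Fin 2) 1 (1 : ℂ) ⊗ₖ jointOracle Q)

/-- A discrete-query circuit `W_k Q W_{k-1} ⋯ W_1 Q W_0`: a finite work register, the computational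
basis state in which the work, control and index registers start, the unitary `W_0`, and the list
`W_1, …, W_k`. None of these data may depend on the oracles. -/
structure QueryCircuit (η d : ℕ) where
  Work : Type
  [fintypeWork : Fintype Work]
  [decidableEqWork : DecidableEq Work]
  initWork : Work
  initControl : Fin 2
  initIndex : Fin η
  first : Matrix.unitaryGroup (Register Work η d) ℂ
  rest : List (Matrix.unitaryGroup (Register Work η d) ℂ)

attribute [instance] QueryCircuit.fintypeWork QueryCircuit.decidableEqWork

/-- The number of queries that the circuit makes. -/
def QueryCircuit.queries {η d : ℕ} (C : QueryCircuit η d) : ℕ := C.rest.length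

/-- The operation `W_k Q W_{k-1} ⋯ W_1 Q W_0` that the circuit performs, where `Q` is the query
gate for the oracles `Q_1, …, Q_η`. -/
def QueryCircuit.eval {η d : ℕ} (C : QueryCircuit η d)
    (Q : Fin η → Matrix (Fin d) (Fin d) ℂ) :
    Matrix (Register C.Work η d) (Register C.Work η d) ℂ :=
  C.rest.foldl (fun M W => W.1 * queryGate C.Work Q * M) C.first.1

/-- The state `|init⟩ ⊗ ψ`: all registers but the target system are in their initial basis
state. -/
def QueryCircuit.embed {η d : ℕ} (C : QueryCircuit η d) (ψ : Fin d → ℂ) :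
    Register C.Work η d → ℂ :=
  fun x => if x.1 = C.initWork ∧ x.2.1 = C.initControl ∧ x.2.2.1 = C.initIndex
    then ψ x.2.2.2 else 0

/-- Run with the oracles `Q`, the circuit implements `U` with error at most `ε`: for every unit
vector `ψ`, it maps `|init⟩ ⊗ ψ` to a state within Euclidean distance `ε` of `|init⟩ ⊗ U ψ`. -/
def QueryCircuit.Implements {η d : ℕ} (C : QueryCircuit η d)
    (Q : Fin η → Matrix (Fin d) (Fin d) ℂ) (U : Matrix (Fin d) (Fin d) ℂ) (ε : ℝ) : Prop :=
  ∀ ψ : Fin d → ℂ, ‖WithLp.toLp 2 ψ‖ = 1 →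
    ‖WithLp.toLp 2 ((C.eval Q).mulVec (C.embed ψ) - C.embed (U.mulVec ψ))‖ ≤ ε

end

open scoped Matrix Matrix.Norms.L2Operator

/-! ### Families of operators computed with a given number of queries -/

/-- `QueryComputable q k F`: the family of matrices `F` is computed by a circuit that uses the query
gates `q` exactly `k` times, with interspersed unitaries that do not depend on the parameter. -/
inductive QueryComputable {ι n : Type*} [Fintype n] [DecidableEq n] (q : ι → Matrix n n ℂ) :
    ℕ → (ι → Matrix n n ℂ) → Prop
  | const (U : Matrix.unitaryGroup n ℂ) : QueryComputable q 0 (fun _ => U.1)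
  | step {k : ℕ} {F : ι → Matrix n n ℂ} (U : Matrix.unitaryGroup n ℂ)
      (hF : QueryComputable q k F) : QueryComputable q (k + 1) (fun x => U.1 * q x * F x)

namespace QueryComputable

variable {ι n : Type*} [Fintype n] [DecidableEq n] {q : ι → Matrix n n ℂ}

theorem const_mul {k : ℕ} {F : ι → Matrix n n ℂ} (U : Matrix.unitaryGroup n ℂ)
    (hF : QueryComputable q k F) : QueryComputable q k (fun x => U.1 * F x) := by
  cases hF with
  | const V => exact const (U * V)
  | step V hF => simpa [Matrix.mul_assoc] using step (U * V) hF

theorem mul {k l : ℕ} {F G : ι → Matrix n n ℂ} (hF : QueryComputable q k F)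
    (hG : QueryComputable q l G) : QueryComputable q (k + l) (fun x => F x * G x) := by
  induction hF with
  | const U => simpa using hG.const_mul U
  | step U _ ih => simpa [Matrix.mul_assoc, add_right_comm] using step U ih

theorem mul_const {k : ℕ} {F : ι → Matrix n n ℂ} (U : Matrix.unitaryGroup n ℂ)
    (hF : QueryComputable q k F) : QueryComputable q k (fun x => F x * U.1) := by
  simpa using hF.mul (const U)

theorem query : QueryComputable q 1 q := by
  simpa using step 1 (const (q := q) 1)

theorem conjTranspose (hq : ∀ x, (q x)ᴴ = q x) {k : ℕ} {F : ι → Matrix n n ℂ}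
    (hF : QueryComputable q k F) : QueryComputable q k (fun x => (F x)ᴴ) := by
  induction hF with
  | const U => exact const (star U)
  | step U _ ih =>
    simpa [Matrix.mul_assoc, hq, Matrix.star_eq_conjTranspose] using (ih.mul query).mul_const (star U)

theorem mem_unitaryGroup (hq : ∀ x, q x ∈ Matrix.unitaryGroup n ℂ) {k : ℕ}
    {F : ι → Matrix n n ℂ} (hF : QueryComputable q k F) (x : ι) :
    F x ∈ Matrix.unitaryGroup n ℂ := by
  induction hF with
  | const U => exact U.2
  | step U _ ih => exact mul_mem (mul_mem U.2 (hq x)) ih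

theorem eq_const {F : ι → Matrix n n ℂ} (hF : QueryComputable q 0 F) :
    ∃ U : Matrix.unitaryGroup n ℂ, F = fun _ => U.1 := by
  cases hF with
  | const U => exact ⟨U, rfl⟩

theorem eq_step {k : ℕ} {F : ι → Matrix n n ℂ} (hF : QueryComputable q (k + 1) F) :
    ∃ (U : Matrix.unitaryGroup n ℂ) (G : ι → Matrix n n ℂ),
      QueryComputable q k G ∧ F = fun x => U.1 * q x * G x := by
  cases hF with
  | step U hG => exact ⟨U, _, hG, rfl⟩

theorem exists_list {k : ℕ} {F : ι → Matrix n n ℂ} (hF : QueryComputable q k F) :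
    ∃ (U : Matrix.unitaryGroup n ℂ) (l : List (Matrix.unitaryGroup n ℂ)), l.length = k ∧
      ∀ x, l.foldl (fun M W => W.1 * q x * M) U.1 = F x := by
  induction hF with
  | const U => exact ⟨U, [], rfl, fun _ => rfl⟩
  | step U _ ih =>
    obtain ⟨V, l, hl, h⟩ := ih
    exact ⟨V, l ++ [U], by simp [hl], fun x => by simp [h]⟩

end QueryComputable

/-! ### Selecting one of several circuits -/

section Select

variable {ι J n : Type*} [Fintype n] [DecidableEq n] [Fintype J] [DecidableEq J]

/-- The block diagonal operator `∑ j, |j⟩⟨j| ⊗ F j`. -/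
def selectGate (F : J → Matrix n n ℂ) : Matrix (J × n) (J × n) ℂ :=
  Matrix.reindexAlgEquiv ℂ ℂ (Equiv.prodComm n J) (Matrix.blockDiagonal F)

theorem selectGate_apply (F : J → Matrix n n ℂ) (x y : J × n) :
    selectGate F x y = if x.1 = y.1 then F x.1 x.2 y.2 else 0 := by
  simp [selectGate, Matrix.blockDiagonal_apply]

theorem selectGate_mul (F G : J → Matrix n n ℂ) :
    selectGate (fun j => F j * G j) = selectGate F * selectGate G := by
  simp only [selectGate, Matrix.blockDiagonal_mul, map_mul]

theorem selectGate_one : selectGate (fun _ : J => (1 : Matrix n n ℂ)) = 1 := by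
  have h := Matrix.blockDiagonal_one (m := n) (o := J) (α := ℂ)
  change selectGate (1 : J → Matrix n n ℂ) = 1
  rw [selectGate, h, map_one]

theorem selectGate_conjTranspose (F : J → Matrix n n ℂ) :
    (selectGate F)ᴴ = selectGate fun j => (F j)ᴴ := by
  ext x y
  simp only [Matrix.conjTranspose_apply, selectGate_apply, eq_comm (a := y.1)]
  split_ifs with h <;> simp [h]

theorem selectGate_mem_unitaryGroup {F : J → Matrix n n ℂ}
    (hF : ∀ j, F j ∈ Matrix.unitaryGroup n ℂ) :
    selectGate F ∈ Matrix.unitaryGroup (J × n) ℂ := by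
  rw [Matrix.mem_unitaryGroup_iff, Matrix.star_eq_conjTranspose, selectGate_conjTranspose,
    ← selectGate_mul, ← selectGate_one]
  congr 1
  ext1 j
  exact Matrix.mem_unitaryGroup_iff.1 (hF j)

theorem QueryComputable.select {q : ι → Matrix n n ℂ} {k : ℕ} {F : J → ι → Matrix n n ℂ}
    (hF : ∀ j, QueryComputable q k (F j)) :
    QueryComputable (fun x => selectGate fun _ : J => q x) k
      (fun x => selectGate fun j => F j x) := by
  induction k generalizing F with
  | zero =>
    choose U hU using fun j => (hF j).eq_const
    simpa [hU] using QueryComputable.const (q := fun x => selectGate fun _ : J => q x)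
      ⟨_, selectGate_mem_unitaryGroup fun j => (U j).2⟩
  | succ k ih =>
    choose U G hG hU using fun j => (hF j).eq_step
    simpa [hU, selectGate_mul] using
      QueryComputable.step ⟨_, selectGate_mem_unitaryGroup fun j => (U j).2⟩ (ih hG)

end Select

/-! ### Operator norms and amplitude amplification -/

section Norm

variable {n m : Type*} [Fintype n] [Fintype m] [DecidableEq m]

theorem l2_opNorm_one_le : ‖(1 : Matrix m m ℂ)‖ ≤ 1 := by
  have h := Matrix.l2_opNorm_conjTranspose_mul_self (1 : Matrix m m ℂ)
  simp only [Matrix.conjTranspose_one, Matrix.mul_one] at h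
  nlinarith [norm_nonneg (1 : Matrix m m ℂ)]

theorem l2_opNorm_le_one_of_conjTranspose_mul_self {E : Matrix n m ℂ} (hE : Eᴴ * E = 1) :
    ‖E‖ ≤ 1 := by
  have h := Matrix.l2_opNorm_conjTranspose_mul_self E
  have h1 := l2_opNorm_one_le (m := m)
  rw [hE] at h
  nlinarith [norm_nonneg E]

theorem l2_opNorm_le_one_of_unitary {U : Matrix m m ℂ} (hU : U ∈ Matrix.unitaryGroup m ℂ) :
    ‖U‖ ≤ 1 :=
  l2_opNorm_le_one_of_conjTranspose_mul_self (Matrix.mem_unitaryGroup_iff'.1 hU)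

theorem l2_opNorm_mul_le_of_left {l : Type*} [Fintype l] [DecidableEq l] {A : Matrix n m ℂ}
    {B : Matrix m l ℂ} (hA : ‖A‖ ≤ 1) : ‖A * B‖ ≤ ‖B‖ :=
  (Matrix.l2_opNorm_mul A B).trans (mul_le_of_le_one_left (norm_nonneg _) hA)

theorem l2_opNorm_mul_le_of_right {l : Type*} [Fintype l] [DecidableEq l] {A : Matrix n m ℂ}
    {B : Matrix m l ℂ} (hB : ‖B‖ ≤ 1) : ‖A * B‖ ≤ ‖A‖ :=
  (Matrix.l2_opNorm_mul A B).trans (mul_le_of_le_one_right (norm_nonneg _) hB)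

/-- The reflection `1 - 2 E Eᴴ` about the orthogonal complement of the range of `E`. -/
theorem one_sub_two_mul_proj_mem_unitaryGroup [DecidableEq n] {E : Matrix n m ℂ} (hE : Eᴴ * E = 1) :
    1 - (2 : ℂ) • (E * Eᴴ) ∈ Matrix.unitaryGroup n ℂ := by
  rw [Matrix.mem_unitaryGroup_iff, Matrix.star_eq_conjTranspose]
  have h : E * Eᴴ * (E * Eᴴ) = E * Eᴴ := by
    rw [Matrix.mul_assoc, ← Matrix.mul_assoc Eᴴ, hE, Matrix.one_mul]
  simp only [Matrix.conjTranspose_sub, Matrix.conjTranspose_one, Matrix.conjTranspose_smul,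
    Matrix.conjTranspose_mul, Matrix.conjTranspose_conjTranspose, Matrix.sub_mul, Matrix.mul_sub,
    Matrix.one_mul, Matrix.mul_one, Matrix.smul_mul, Matrix.mul_smul, h]
  rw [show star (2 : ℂ) = 2 by simp]
  module

/-- One round of oblivious amplitude amplification. -/
theorem amplification_error [DecidableEq n] {E : Matrix n m ℂ} (hE : Eᴴ * E = 1) {W : Matrix n n ℂ}
    (hW : W ∈ Matrix.unitaryGroup n ℂ) {S V : Matrix m m ℂ} (hV : Vᴴ * V = 1)
    (hS : Eᴴ * W * E = (1 / 2 : ℂ) • S) {δ : ℝ} (hδ : δ ≤ 1) (hSV : ‖V - S‖ ≤ δ) :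
    ‖-(W * (1 - (2 : ℂ) • (E * Eᴴ)) * Wᴴ * (1 - (2 : ℂ) • (E * Eᴴ)) * W) * E - E * V‖
      ≤ 4 * δ := by
  have hSt : Eᴴ * (Wᴴ * E) = (1 / 2 : ℂ) • Sᴴ := by
    simpa [Matrix.conjTranspose_mul, Matrix.mul_assoc] using congrArg Matrix.conjTranspose hS
  have hWW : Wᴴ * W = 1 := Matrix.mem_unitaryGroup_iff'.1 hW
  have hWt : W * Wᴴ = 1 := Matrix.mem_unitaryGroup_iff.1 hW
  have s1 : (1 - (2 : ℂ) • (E * Eᴴ)) * (W * E) = W * E - E * S := by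
    rw [Matrix.sub_mul, Matrix.one_mul, Matrix.smul_mul, Matrix.mul_assoc E, ← Matrix.mul_assoc Eᴴ,
      hS, Matrix.mul_smul, smul_smul]
    norm_num
  have s2 : Wᴴ * (W * E - E * S) = E - Wᴴ * E * S := by
    rw [Matrix.mul_sub, ← Matrix.mul_assoc, hWW, Matrix.one_mul, Matrix.mul_assoc]
  have s3 : (1 - (2 : ℂ) • (E * Eᴴ)) * (E - Wᴴ * E * S) = E * (Sᴴ * S) - E - Wᴴ * E * S := by
    rw [Matrix.sub_mul, Matrix.one_mul, Matrix.smul_mul, Matrix.mul_assoc E, Matrix.mul_sub Eᴴ, hE,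
      ← Matrix.mul_assoc Eᴴ, hSt, Matrix.mul_sub, Matrix.mul_one, Matrix.smul_mul, Matrix.mul_smul]
    module
  have s4 : W * (E * (Sᴴ * S) - E - Wᴴ * E * S) = W * (E * (Sᴴ * S)) - W * E - E * S := by
    rw [Matrix.mul_sub, Matrix.mul_sub, Matrix.mul_assoc Wᴴ, ← Matrix.mul_assoc W Wᴴ, hWt,
      Matrix.one_mul]
  have key : -(W * (1 - (2 : ℂ) • (E * Eᴴ)) * Wᴴ * (1 - (2 : ℂ) • (E * Eᴴ)) * W) * E - E * V
      = -(E * (V - S)) + W * (E * ((V - S)ᴴ * V + Sᴴ * (V - S))) := by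
    have h1 : (V - S)ᴴ * V + Sᴴ * (V - S) = 1 - Sᴴ * S := by
      rw [Matrix.conjTranspose_sub, Matrix.sub_mul, hV, Matrix.mul_sub]; abel
    have h2 : W * (1 - (2 : ℂ) • (E * Eᴴ)) * Wᴴ * (1 - (2 : ℂ) • (E * Eᴴ)) * W * E
        = W * ((1 - (2 : ℂ) • (E * Eᴴ)) * (Wᴴ * ((1 - (2 : ℂ) • (E * Eᴴ)) * (W * E)))) := by
      generalize 1 - (2 : ℂ) • (E * Eᴴ) = R
      simp only [Matrix.mul_assoc]
    rw [h1, Matrix.neg_mul, h2, s1, s2, s3, s4]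
    simp only [Matrix.mul_sub, Matrix.mul_one]
    abel
  have hE1 := l2_opNorm_le_one_of_conjTranspose_mul_self hE
  have hW1 := l2_opNorm_le_one_of_unitary hW
  have hV1 := l2_opNorm_le_one_of_conjTranspose_mul_self hV
  have hSn : ‖S‖ ≤ 2 := by
    have := norm_sub_norm_le S V
    rw [norm_sub_rev] at this
    linarith
  have e1 : ‖E * (V - S)‖ ≤ δ := (l2_opNorm_mul_le_of_left hE1).trans hSV
  have e2 : ‖W * (E * ((V - S)ᴴ * V + Sᴴ * (V - S)))‖ ≤ 3 * δ := by
    refine (l2_opNorm_mul_le_of_left hW1).trans ((l2_opNorm_mul_le_of_left hE1).trans ?_)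
    have h1 : ‖(V - S)ᴴ * V‖ ≤ δ := by
      refine (l2_opNorm_mul_le_of_right hV1).trans ?_
      rwa [Matrix.l2_opNorm_conjTranspose]
    have h2 : ‖Sᴴ * (V - S)‖ ≤ 2 * δ := by
      refine (Matrix.l2_opNorm_mul _ _).trans ?_
      rw [Matrix.l2_opNorm_conjTranspose]
      exact mul_le_mul hSn hSV (norm_nonneg _) (by norm_num)
    linarith [norm_add_le ((V - S)ᴴ * V) (Sᴴ * (V - S))]
  rw [key]
  refine (norm_add_le _ _).trans ?_
  rw [norm_neg]
  linarith

/-- Every unit vector is the image of a given basis vector under some unitary. -/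
theorem exists_unitary_column (j₀ : m) (r : m → ℂ) (hr : ∑ j, ‖r j‖ ^ 2 = 1) :
    ∃ U : Matrix.unitaryGroup m ℂ, ∀ j, U.1 j j₀ = r j := by
  have hn : ‖(WithLp.toLp 2 r : EuclideanSpace ℂ m)‖ = 1 := by
    rw [EuclideanSpace.norm_eq, hr, Real.sqrt_one]
  have ho : Orthonormal ℂ (({j₀} : Set m).domRestrict
      fun _ : m => (WithLp.toLp 2 r : EuclideanSpace ℂ m)) := by
    refine ⟨fun _ => hn, fun i j hij => (hij (Subsingleton.elim i j)).elim⟩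
  obtain ⟨b, hb⟩ := ho.exists_orthonormalBasis_extension_of_card_eq (by simp)
  refine ⟨⟨_, (EuclideanSpace.basisFun m ℂ).toMatrix_orthonormalBasis_mem_unitary b⟩, fun j => ?_⟩
  simp [Module.Basis.toMatrix_apply, hb j₀ rfl]

end Norm

/-! ### Sign oracles and the query gate -/

section Oracle

variable {η d : ℕ}

theorem IsSignOracle.conjTranspose_eq {Q : Matrix (Fin d) (Fin d) ℂ} (hQ : IsSignOracle Q) :
    Qᴴ = Q := by
  have hn : IsStarNormal Q :=
    ⟨by rw [Commute, SemiconjBy, Matrix.mem_unitaryGroup_iff.1 hQ.1,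
      Matrix.mem_unitaryGroup_iff'.1 hQ.1]⟩
  have h := cfc_star_id (R := ℂ) Q
  rw [cfc_congr (g := id) fun x hx => ?_, cfc_id ℂ Q] at h
  · exact h.symm
  · rcases hQ.2 hx with rfl | rfl <;> simp

theorem IsSignOracle.mul_self {Q : Matrix (Fin d) (Fin d) ℂ} (hQ : IsSignOracle Q) :
    Q * Q = 1 := by
  have h := Matrix.mem_unitaryGroup_iff.1 hQ.1
  rwa [Matrix.star_eq_conjTranspose, hQ.conjTranspose_eq] at h

/-- The query gate without the work register. -/
def controlledOracle (Q : Fin η → Matrix (Fin d) (Fin d) ℂ) :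
    Matrix (Fin 2 × (Fin η × Fin d)) (Fin 2 × (Fin η × Fin d)) ℂ :=
  selectGate fun c : Fin 2 => selectGate fun i : Fin η => if c = 0 then 1 else Q i

theorem queryGate_eq_selectGate (Work : Type) [Fintype Work] [DecidableEq Work]
    (Q : Fin η → Matrix (Fin d) (Fin d) ℂ) :
    queryGate Work Q = selectGate fun _ : Work => controlledOracle Q := by
  ext ⟨w, c, i, x⟩ ⟨w', c', i', x'⟩
  simp only [queryGate, controlledOracle, selectGate_apply, jointOracle, Matrix.kroneckerMap_apply,
    Matrix.add_apply, Matrix.one_apply, Matrix.sum_apply, Matrix.single_apply]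
  fin_cases c <;> fin_cases c' <;> by_cases h : i = i' <;> simp [h, Matrix.one_apply]
  · split_ifs <;> rfl
  · exact fun _ => Finset.sum_eq_zero fun a _ => if_neg fun ha => h (ha.1.symm.trans ha.2)

theorem controlledOracle_conjTranspose {Q : Fin η → Matrix (Fin d) (Fin d) ℂ}
    (hQ : ∀ j, IsSignOracle (Q j)) : (controlledOracle Q)ᴴ = controlledOracle Q := by
  simp only [controlledOracle, selectGate_conjTranspose]
  congr! 4
  split_ifs <;> simp [(hQ _).conjTranspose_eq]

theorem controlledOracle_mem_unitaryGroup {Q : Fin η → Matrix (Fin d) (Fin d) ℂ}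
    (hQ : ∀ j, IsSignOracle (Q j)) :
    controlledOracle Q ∈ Matrix.unitaryGroup (Fin 2 × (Fin η × Fin d)) ℂ := by
  refine selectGate_mem_unitaryGroup fun c => selectGate_mem_unitaryGroup fun i => ?_
  split_ifs
  exacts [one_mem _, (hQ i).1]

/-- The isometry `|c⟩|i⟩ ⊗ 1` from the target system to control, index and target. -/
def targetEmbedding (d : ℕ) (c : Fin 2) (i : Fin η) :
    Matrix (Fin 2 × (Fin η × Fin d)) (Fin d) ℂ :=
  fun h x => if h = (c, (i, x)) then 1 else 0

theorem targetEmbedding_conjTranspose_mul_self (c : Fin 2) (i : Fin η) :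
    (targetEmbedding d c i)ᴴ * targetEmbedding d c i = 1 := by
  ext x y
  simp [targetEmbedding, Matrix.mul_apply, Matrix.one_apply, eq_comm, apply_ite]

theorem controlledOracle_mul_targetEmbedding_zero (Q : Fin η → Matrix (Fin d) (Fin d) ℂ)
    (i : Fin η) : controlledOracle Q * targetEmbedding d 0 i = targetEmbedding d 0 i := by
  ext ⟨c, j, x⟩ y
  simp [targetEmbedding, Matrix.mul_apply, controlledOracle, selectGate_apply]
  by_cases hc : c = 0 <;> by_cases hj : j = i <;> simp [hc, hj, Matrix.one_apply]

theorem controlledOracle_mul_targetEmbedding_one (Q : Fin η → Matrix (Fin d) (Fin d) ℂ)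
    (i : Fin η) : controlledOracle Q * targetEmbedding d 1 i = targetEmbedding d 1 i * Q i := by
  ext ⟨c, j, x⟩ y
  simp [targetEmbedding, Matrix.mul_apply, controlledOracle, selectGate_apply]
  by_cases hc : c = 1 <;> by_cases hj : j = i <;> simp [hc, hj]

/-- The gate that exchanges the basis states `|0⟩|i₀⟩` and `|1⟩|i⟩` of control and index. -/
theorem exists_swapGate (i₀ i : Fin η) :
    ∃ P : Matrix.unitaryGroup (Fin 2 × (Fin η × Fin d)) ℂ,
      P.1 * targetEmbedding d 0 i₀ = targetEmbedding d 1 i := by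
  let σ : Equiv.Perm (Fin 2 × (Fin η × Fin d)) :=
    ((Equiv.prodAssoc _ _ _).symm.trans
      ((Equiv.swap (0, i₀) (1, i)).prodCongr (Equiv.refl (Fin d)))).trans (Equiv.prodAssoc _ _ _)
  refine ⟨⟨σ.permMatrix ℂ, ?_⟩, ?_⟩
  · rw [Matrix.mem_unitaryGroup_iff, Matrix.star_eq_conjTranspose, Matrix.conjTranspose_permMatrix,
      ← Matrix.permMatrix_mul]
    simp
  · ext ⟨c, j, x⟩ y
    have h := congrFun (Matrix.permMatrix_mulVec σ (v := fun h => targetEmbedding d 0 i₀ h y))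
      (c, j, x)
    refine h.trans ?_
    have hσ : σ (c, j, x) = (0, i₀, y) ↔ (c, j, x) = (1, i, y) := by
      rw [← Equiv.eq_symm_apply]
      simp [σ]
    simp only [Function.comp_apply, targetEmbedding, hσ]

/-- The gate `U` on the target system. -/
theorem exists_targetGate (U : Matrix.unitaryGroup (Fin d) ℂ) (i₀ : Fin η) :
    ∃ P : Matrix.unitaryGroup (Fin 2 × (Fin η × Fin d)) ℂ,
      P.1 * targetEmbedding d 0 i₀ = targetEmbedding d 0 i₀ * U.1 := by
  refine ⟨⟨selectGate fun _ => selectGate fun _ => U.1, selectGate_mem_unitaryGroup fun _ =>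
    selectGate_mem_unitaryGroup fun _ => U.2⟩, ?_⟩
  ext ⟨c, j, x⟩ y
  simp [targetEmbedding, Matrix.mul_apply, selectGate_apply]
  by_cases hc : c = 0 <;> by_cases hj : j = i₀ <;> simp [hc, hj]

end Oracle

/-! ### Linear combinations of operators computed with few queries -/

/-- The families of oracles on which the circuits are run. -/
abbrev OracleFamily (η d : ℕ) : Type :=
  {Q : Fin η → Matrix (Fin d) (Fin d) ℂ // ∀ j, IsSignOracle (Q j)}

section Combination

variable {η d : ℕ}

/-- `V` is performed exactly on the target system by a circuit with `k` queries that needs no work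
register and returns control and index to the state `|0⟩|i₀⟩`. -/
def TargetComputable (i₀ : Fin η) (k : ℕ)
    (V : OracleFamily η d → Matrix (Fin d) (Fin d) ℂ) : Prop :=
  ∃ F, QueryComputable (fun Q : OracleFamily η d => controlledOracle Q.1) k F ∧
    ∀ Q, F Q * targetEmbedding d 0 i₀ = targetEmbedding d 0 i₀ * V Q

namespace TargetComputable

variable {i₀ : Fin η} {k : ℕ} {V : OracleFamily η d → Matrix (Fin d) (Fin d) ℂ}

theorem gate_mul (U : Matrix.unitaryGroup (Fin d) ℂ) (hV : TargetComputable i₀ k V) :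
    TargetComputable i₀ k (fun Q => U.1 * V Q) := by
  obtain ⟨F, hF, h⟩ := hV
  obtain ⟨P, hP⟩ := exists_targetGate U i₀
  refine ⟨_, hF.const_mul P, fun Q => ?_⟩
  rw [Matrix.mul_assoc, h, ← Matrix.mul_assoc, hP, Matrix.mul_assoc]

theorem succ (hV : TargetComputable i₀ k V) : TargetComputable i₀ (k + 1) V := by
  obtain ⟨F, hF, h⟩ := hV
  refine ⟨_, hF.step 1, fun Q => ?_⟩
  rw [OneMemClass.coe_one, Matrix.one_mul, Matrix.mul_assoc, h, ← Matrix.mul_assoc,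
    controlledOracle_mul_targetEmbedding_zero]

theorem one (k : ℕ) : TargetComputable (d := d) i₀ k (fun _ => 1) := by
  induction k with
  | zero => exact ⟨_, .const 1, fun Q => by simp⟩
  | succ k ih => exact ih.succ

theorem oracle_mul (i : Fin η) (hV : TargetComputable i₀ k V) :
    TargetComputable i₀ (k + 1) (fun Q => Q.1 i * V Q) := by
  obtain ⟨F, hF, h⟩ := hV
  obtain ⟨P, hP⟩ := exists_swapGate (d := d) i₀ i
  have hP' : (star P).1 * targetEmbedding d 1 i = targetEmbedding d 0 i₀ := by
    rw [← hP, ← Matrix.mul_assoc, Unitary.coe_star, Unitary.coe_star_mul_self, Matrix.one_mul]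
  refine ⟨_, (hF.const_mul P).step (star P), fun Q => ?_⟩
  rw [Matrix.mul_assoc, Matrix.mul_assoc P.1, h, ← Matrix.mul_assoc P.1, hP,
    Matrix.mul_assoc (star P).1, ← Matrix.mul_assoc (controlledOracle Q.1),
    controlledOracle_mul_targetEmbedding_one, ← Matrix.mul_assoc, ← Matrix.mul_assoc, hP',
    Matrix.mul_assoc]

end TargetComputable

/-- `F` is a linear combination, with nonnegative coefficients of sum `s`, of operators computed
with `k` queries. -/
def IsQueryCombination (i₀ : Fin η) (k : ℕ) (s : ℝ)
    (F : OracleFamily η d → Matrix (Fin d) (Fin d) ℂ) : Prop :=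
  ∃ L : List (ℝ × (OracleFamily η d → Matrix (Fin d) (Fin d) ℂ)),
    (∀ p ∈ L, 0 ≤ p.1 ∧ TargetComputable i₀ k p.2) ∧ (L.map Prod.fst).sum = s ∧
      ∀ Q, (L.map fun p => (p.1 : ℂ) • p.2 Q).sum = F Q

namespace IsQueryCombination

variable {i₀ : Fin η} {k : ℕ} {s : ℝ} {F : OracleFamily η d → Matrix (Fin d) (Fin d) ℂ}

theorem zero : IsQueryCombination (d := d) i₀ k 0 (fun _ => 0) :=
  ⟨[], by simp, rfl, fun _ => rfl⟩

theorem of_targetComputable (hF : TargetComputable i₀ k F) : IsQueryCombination i₀ k 1 F :=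
  ⟨[(1, F)], by simpa using hF, by simp, fun _ => by simp⟩

theorem add {t : ℝ} {G : OracleFamily η d → Matrix (Fin d) (Fin d) ℂ}
    (hF : IsQueryCombination i₀ k s F) (hG : IsQueryCombination i₀ k t G) :
    IsQueryCombination i₀ k (s + t) (fun Q => F Q + G Q) := by
  obtain ⟨L, h1, h2, h3⟩ := hF
  obtain ⟨M, g1, g2, g3⟩ := hG
  refine ⟨L ++ M, fun p hp => ?_, by simp [h2, g2], fun Q => by
    simp only [List.map_append, List.sum_append, h3, g3]⟩
  rcases List.mem_append.1 hp with hp | hp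
  exacts [h1 p hp, g1 p hp]

theorem mul_left {l : ℕ} {A : OracleFamily η d → Matrix (Fin d) (Fin d) ℂ}
    (hA : ∀ {V}, TargetComputable i₀ k V → TargetComputable i₀ l (fun Q => A Q * V Q))
    (hF : IsQueryCombination i₀ k s F) : IsQueryCombination i₀ l s (fun Q => A Q * F Q) := by
  obtain ⟨L, h1, h2, h3⟩ := hF
  refine ⟨L.map fun p => (p.1, fun Q => A Q * p.2 Q), ?_, ?_, fun Q => ?_⟩
  · intro p hp
    obtain ⟨p', hp', rfl⟩ := List.mem_map.1 hp
    exact ⟨(h1 p' hp').1, hA (h1 p' hp').2⟩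
  · simpa [Function.comp_def] using h2
  · change _ = A Q * F Q
    rw [← h3, ← List.sum_map_mul_left]
    simp [Function.comp_def]

theorem gate_mul (U : Matrix.unitaryGroup (Fin d) ℂ) (hF : IsQueryCombination i₀ k s F) :
    IsQueryCombination i₀ k s (fun Q => U.1 * F Q) :=
  hF.mul_left fun h => h.gate_mul U

theorem oracle_mul (i : Fin η) (hF : IsQueryCombination i₀ k s F) :
    IsQueryCombination i₀ (k + 1) s (fun Q => Q.1 i * F Q) :=
  hF.mul_left fun h => h.oracle_mul i

theorem smul_nonneg {c : ℝ} (hc : 0 ≤ c) (hF : IsQueryCombination i₀ k s F) :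
    IsQueryCombination i₀ k (c * s) (fun Q => (c : ℂ) • F Q) := by
  obtain ⟨L, h1, h2, h3⟩ := hF
  refine ⟨L.map fun p => (c * p.1, p.2), ?_, ?_, fun Q => ?_⟩
  · intro p hp
    obtain ⟨p', hp', rfl⟩ := List.mem_map.1 hp
    exact ⟨mul_nonneg hc (h1 p' hp').1, (h1 p' hp').2⟩
  · rw [← h2, ← List.sum_map_mul_left]
    simp [Function.comp_def]
  · change _ = (c : ℂ) • F Q
    rw [← h3, List.smul_sum]
    simp [Function.comp_def, smul_smul]

theorem smul (z : ℂ) (hF : IsQueryCombination i₀ k s F) :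
    IsQueryCombination i₀ k (‖z‖ * s) (fun Q => z • F Q) := by
  obtain ⟨u, hu, hz⟩ : ∃ u : ℂ, star u * u = 1 ∧ (‖z‖ : ℂ) * u = z := by
    refine ⟨Complex.exp (z.arg * Complex.I), ?_, Complex.norm_mul_exp_arg_mul_I z⟩
    have h := Complex.conj_mul' (Complex.exp (z.arg * Complex.I))
    rw [Complex.norm_exp_ofReal_mul_I] at h
    simpa using h
  have hU : u • (1 : Matrix (Fin d) (Fin d) ℂ) ∈ Matrix.unitaryGroup (Fin d) ℂ := by
    rw [Matrix.mem_unitaryGroup_iff, Matrix.star_eq_conjTranspose, Matrix.conjTranspose_smul]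
    simp only [Matrix.conjTranspose_one, Matrix.smul_mul, Matrix.mul_smul, Matrix.one_mul,
      smul_smul, hu, one_smul]
  simpa [smul_smul, hz] using (hF.gate_mul ⟨_, hU⟩).smul_nonneg (norm_nonneg z)

/-- A combination of total weight `s` can be padded to any larger total weight. -/
theorem mono {t : ℝ} (hst : s ≤ t) (hF : IsQueryCombination i₀ k s F) :
    IsQueryCombination i₀ k t F := by
  have h1 := (of_targetComputable (i₀ := i₀) (.one (d := d) k)).smul (((t - s) / 2 : ℝ) : ℂ)
  have h2 := (of_targetComputable (i₀ := i₀) (.one (d := d) k)).smul ((-((t - s) / 2) : ℝ) : ℂ)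
  have h := (hF.add h1).add h2
  have hn : |t - s| = t - s := abs_of_nonneg (sub_nonneg.2 hst)
  convert h using 2
  · simp only [Complex.norm_real, Real.norm_eq_abs, abs_neg, abs_div, hn]
    norm_num
    ring
  · simp

end IsQueryCombination

/-! ### Block encodings -/

/-- The operator `r ⊗ e`, for a state `r` of the work register. -/
def workEmbedding {J n m : Type*} (r : J → ℂ) (e : Matrix n m ℂ) : Matrix (J × n) m ℂ :=
  fun x y => r x.1 * e x.2 y

section WorkEmbedding

variable {J n m : Type*} [Fintype J] [Fintype n] [DecidableEq n]

theorem workEmbedding_conjTranspose_mul_selectGate_mul [DecidableEq J] (r : J → ℂ) (e : Matrix n m ℂ)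
    (F : J → Matrix n n ℂ) :
    (workEmbedding r e)ᴴ * (selectGate F * workEmbedding r e) =
      ∑ j, (star (r j) * r j) • (eᴴ * (F j * e)) := by
  ext x y
  simp only [Matrix.mul_apply, Matrix.conjTranspose_apply, workEmbedding, selectGate_apply,
    Fintype.sum_prod_type, Matrix.sum_apply, Matrix.smul_apply, star_mul', ite_mul, zero_mul,
    smul_eq_mul]
  refine Finset.sum_congr rfl fun j _ => ?_
  rw [Finset.mul_sum]
  refine Finset.sum_congr rfl fun h _ => ?_
  rw [Finset.sum_eq_single j (fun k _ hk => by simp [hk.symm]) (by simp)]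
  simp only [if_true, Finset.mul_sum]
  exact Finset.sum_congr rfl fun h' _ => by ring

theorem kronecker_one_mul_workEmbedding (U : Matrix J J ℂ) (r : J → ℂ) (e : Matrix n m ℂ) :
    (U ⊗ₖ (1 : Matrix n n ℂ)) * workEmbedding r e = workEmbedding (U *ᵥ r) e := by
  ext x y
  simp only [Matrix.mul_apply, Matrix.kroneckerMap_apply, workEmbedding, Fintype.sum_prod_type,
    Matrix.one_apply, Matrix.mulVec, dotProduct, Finset.sum_mul]
  refine Finset.sum_congr rfl fun j _ => ?_
  rw [Finset.sum_eq_single x.2 (fun k _ hk => by simp [hk.symm]) (by simp)]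
  simp [mul_assoc]

theorem selectGate_mul_workEmbedding [DecidableEq J] (F : Matrix n n ℂ) (r : J → ℂ)
    (e : Matrix n m ℂ) :
    (selectGate fun _ : J => F) * workEmbedding r e = workEmbedding r (F * e) := by
  ext x y
  simp only [Matrix.mul_apply, workEmbedding, selectGate_apply, Fintype.sum_prod_type, ite_mul,
    zero_mul]
  rw [Finset.sum_eq_single x.1 (fun k _ hk => by simp [hk.symm]) (by simp)]
  simp only [if_true, Finset.mul_sum]
  exact Finset.sum_congr rfl fun h' _ => by ring

end WorkEmbedding

theorem workEmbedding_mul {J n m : Type*} [Fintype m] (r : J → ℂ) (e : Matrix n m ℂ)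
    (U : Matrix m m ℂ) : workEmbedding r (e * U) = workEmbedding r e * U := by
  ext x y
  simp only [Matrix.mul_apply, workEmbedding, Finset.mul_sum, mul_assoc]

/-- The isometry that adjoins all registers but the target system in their initial states. -/
def registerEmbedding {J : Type*} [DecidableEq J] (d : ℕ) (j₀ : J) (i₀ : Fin η) :
    Matrix (J × (Fin 2 × (Fin η × Fin d))) (Fin d) ℂ :=
  workEmbedding (Pi.single j₀ 1) (targetEmbedding d 0 i₀)

theorem registerEmbedding_conjTranspose_mul_self {J : Type*} [Fintype J] [DecidableEq J]
    (j₀ : J) (i₀ : Fin η) :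
    (registerEmbedding d j₀ i₀)ᴴ * registerEmbedding d j₀ i₀ = 1 := by
  have h := workEmbedding_conjTranspose_mul_selectGate_mul (Pi.single j₀ (1 : ℂ))
    (targetEmbedding d 0 i₀) (fun _ => 1)
  rw [selectGate_one, Matrix.one_mul] at h
  rw [registerEmbedding, h, Finset.sum_eq_single j₀ (fun k _ hk => by simp [hk]) (by simp)]
  simp [targetEmbedding_conjTranspose_mul_self]

theorem exists_blockEncoding_of_list {i₀ : Fin η} {k M : ℕ} (j₀ : Fin M)
    (L : List (ℝ × (OracleFamily η d → Matrix (Fin d) (Fin d) ℂ))) (hM : L.length = M)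
    (hL : ∀ p ∈ L, 0 ≤ p.1 ∧ TargetComputable i₀ k p.2) (hs : (L.map Prod.fst).sum = 2) :
    ∃ W, QueryComputable (fun Q : OracleFamily η d => queryGate (Fin M) Q.1) k W ∧
      ∀ Q, (registerEmbedding d j₀ i₀)ᴴ * W Q * registerEmbedding d j₀ i₀ =
        (1 / 2 : ℂ) • (L.map fun p => (p.1 : ℂ) • p.2 Q).sum := by
  subst hM
  choose G hG hGe using fun j : Fin L.length => (hL L[j] (List.getElem_mem _)).2
  have hnn : ∀ j : Fin L.length, 0 ≤ L[j].1 / 2 := fun j =>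
    div_nonneg (hL L[j] (List.getElem_mem _)).1 (by norm_num)
  set r : Fin L.length → ℂ := fun j => (Real.sqrt (L[j].1 / 2) : ℂ) with hr
  have hr2 : ∀ j, star (r j) * r j = ((L[j].1 / 2 : ℝ) : ℂ) := fun j => by
    simp only [hr, Complex.star_def, Complex.conj_ofReal]
    rw [← Complex.ofReal_mul, Real.mul_self_sqrt (hnn j)]
  obtain ⟨U, hU⟩ := exists_unitary_column j₀ r (by
    have : ∀ j, ‖r j‖ ^ 2 = L[j].1 / 2 := fun j => by
      simp only [hr, Complex.norm_real, Real.norm_eq_abs, sq_abs, Real.sq_sqrt (hnn j)]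
    simp only [this]
    rw [← Finset.sum_div]
    have h := Fin.sum_univ_fun_getElem L Prod.fst
    simp only [Fin.getElem_fin]
    rw [h, hs]
    norm_num)
  have hPU : U.1 ⊗ₖ (1 : Matrix (Fin 2 × (Fin η × Fin d)) (Fin 2 × (Fin η × Fin d)) ℂ) ∈
      Matrix.unitaryGroup _ ℂ := Matrix.kronecker_mem_unitary U.2 (one_mem _)
  set P : Matrix.unitaryGroup (Register (Fin L.length) η d) ℂ := ⟨_, hPU⟩ with hP
  have hPE : P.1 * registerEmbedding d j₀ i₀ = workEmbedding r (targetEmbedding d 0 i₀) := by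
    rw [hP, registerEmbedding, kronecker_one_mul_workEmbedding]
    congr 1
    ext j
    simp [hU]
  have hq : (fun Q : OracleFamily η d => queryGate (Fin L.length) Q.1) =
      fun Q => selectGate fun _ => controlledOracle Q.1 :=
    funext fun Q => queryGate_eq_selectGate _ _
  rw [hq]
  refine ⟨_, ((QueryComputable.select hG).mul_const P).const_mul (star P), fun Q => ?_⟩
  have e1 : (registerEmbedding d j₀ i₀)ᴴ * (star P).1 =
      (workEmbedding r (targetEmbedding d 0 i₀))ᴴ := by
    rw [← hPE, Matrix.conjTranspose_mul]
    rfl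
  rw [← Matrix.mul_assoc, e1, Matrix.mul_assoc, Matrix.mul_assoc, hPE,
    workEmbedding_conjTranspose_mul_selectGate_mul]
  simp only [hGe, hr2, ← Matrix.mul_assoc, targetEmbedding_conjTranspose_mul_self, Matrix.one_mul]
  have h := Fin.sum_univ_fun_getElem L fun p => (p.1 : ℂ) • p.2 Q
  rw [← h, Finset.smul_sum]
  refine Finset.sum_congr rfl fun j _ => ?_
  rw [smul_smul]
  congr 1
  simp
  ring

theorem IsQueryCombination.exists_blockEncoding {i₀ : Fin η} {k : ℕ}
    {F : OracleFamily η d → Matrix (Fin d) (Fin d) ℂ} (hF : IsQueryCombination i₀ k 2 F) :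
    ∃ N₀ : ℕ, ∀ N ≥ N₀, ∃ W,
      QueryComputable (fun Q : OracleFamily η d => queryGate (Fin (N + 1)) Q.1) k W ∧
        ∀ Q, (registerEmbedding d (0 : Fin (N + 1)) i₀)ᴴ * W Q *
          registerEmbedding d (0 : Fin (N + 1)) i₀ =
          (1 / 2 : ℂ) • F Q := by
  obtain ⟨L, h1, h2, h3⟩ := hF
  refine ⟨L.length, fun N hN => ?_⟩
  obtain ⟨W, hW, h⟩ := exists_blockEncoding_of_list (i₀ := i₀) (k := k) (0 : Fin (N + 1))
    (L ++ List.replicate (N + 1 - L.length) (0, fun _ => 1)) (by simp; omega)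
    (fun p hp => by
      rcases List.mem_append.1 hp with hp | hp
      · exact h1 p hp
      · rw [List.eq_of_mem_replicate hp]
        exact ⟨le_rfl, .one k⟩)
    (by simp [h2])
  exact ⟨W, hW, fun Q => by rw [h, List.map_append, List.sum_append, h3]; simp⟩

/-! ### Approximate simulation -/

/-- A circuit with `k` queries and work register `Fin (N + 1)` implements `V` up to an error of
`δ` in the operator norm. -/
def IsSimulable (i₀ : Fin η) (N k : ℕ) (V : OracleFamily η d → Matrix (Fin d) (Fin d) ℂ)
    (δ : ℝ) : Prop :=
  ∃ A, QueryComputable (fun Q : OracleFamily η d => queryGate (Fin (N + 1)) Q.1) k A ∧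
    ∀ Q, ‖A Q * registerEmbedding d (0 : Fin (N + 1)) i₀ -
      registerEmbedding d (0 : Fin (N + 1)) i₀ * V Q‖ ≤ δ

theorem queryGate_conjTranspose (N : ℕ) (Q : OracleFamily η d) :
    (queryGate (Fin (N + 1)) Q.1)ᴴ = queryGate (Fin (N + 1)) Q.1 := by
  rw [queryGate_eq_selectGate, selectGate_conjTranspose, controlledOracle_conjTranspose Q.2]

theorem queryGate_mem_unitaryGroup (N : ℕ) (Q : OracleFamily η d) :
    queryGate (Fin (N + 1)) Q.1 ∈ Matrix.unitaryGroup (Register (Fin (N + 1)) η d) ℂ := by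
  rw [queryGate_eq_selectGate]
  exact selectGate_mem_unitaryGroup fun _ => controlledOracle_mem_unitaryGroup Q.2

namespace IsSimulable

variable {i₀ : Fin η} {N k l : ℕ} {V V' : OracleFamily η d → Matrix (Fin d) (Fin d) ℂ} {δ δ' : ℝ}

theorem mul (hV : IsSimulable i₀ N k V δ) (hV' : IsSimulable i₀ N l V' δ')
    (hu : ∀ Q, V' Q ∈ Matrix.unitaryGroup (Fin d) ℂ) :
    IsSimulable i₀ N (k + l) (fun Q => V Q * V' Q) (δ + δ') := by
  obtain ⟨A, hA, h⟩ := hV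
  obtain ⟨A', hA', h'⟩ := hV'
  refine ⟨_, hA.mul hA', fun Q => ?_⟩
  specialize h Q
  specialize h' Q
  set E := registerEmbedding d (0 : Fin (N + 1)) i₀
  have e : A Q * A' Q * E - E * (V Q * V' Q) =
      (A Q * E - E * V Q) * V' Q + A Q * (A' Q * E - E * V' Q) := by
    simp only [Matrix.sub_mul, Matrix.mul_sub, Matrix.mul_assoc]
    abel
  rw [e]
  refine (norm_add_le _ _).trans (add_le_add ?_ ?_)
  · exact (l2_opNorm_mul_le_of_right (l2_opNorm_le_one_of_unitary (hu Q))).trans h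
  · exact (l2_opNorm_mul_le_of_left (l2_opNorm_le_one_of_unitary
      (hA.mem_unitaryGroup (queryGate_mem_unitaryGroup N) Q))).trans h'

theorem of_gate (U : Matrix.unitaryGroup (Fin d) ℂ) : IsSimulable i₀ N 0 (fun _ => U.1) 0 := by
  obtain ⟨P, hP⟩ := exists_targetGate U i₀
  refine ⟨_, .const ⟨selectGate fun _ => P.1, selectGate_mem_unitaryGroup fun _ => P.2⟩,
    fun Q => ?_⟩
  have h : (selectGate fun _ : Fin (N + 1) => P.1) * registerEmbedding d (0 : Fin (N + 1)) i₀ =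
      registerEmbedding d (0 : Fin (N + 1)) i₀ * U.1 := by
    rw [registerEmbedding, selectGate_mul_workEmbedding, hP, workEmbedding_mul]
  exact (norm_sub_eq_zero_iff.2 h).le

end IsSimulable

theorem IsQueryCombination.exists_isSimulable {i₀ : Fin η} {k : ℕ}
    {F V : OracleFamily η d → Matrix (Fin d) (Fin d) ℂ} (hF : IsQueryCombination i₀ k 2 F)
    (hV : ∀ Q, V Q ∈ Matrix.unitaryGroup (Fin d) ℂ) {δ : ℝ} (hδ : δ ≤ 1)
    (h : ∀ Q, ‖V Q - F Q‖ ≤ δ) :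
    ∃ N₀ : ℕ, ∀ N ≥ N₀, IsSimulable i₀ N (3 * k) V (4 * δ) := by
  obtain ⟨N₀, hN₀⟩ := hF.exists_blockEncoding
  refine ⟨N₀, fun N hN => ?_⟩
  obtain ⟨W, hW, hB⟩ := hN₀ N hN
  have hE := registerEmbedding_conjTranspose_mul_self (d := d) (0 : Fin (N + 1)) i₀
  obtain ⟨R, hR⟩ : ∃ R : Matrix.unitaryGroup (Register (Fin (N + 1)) η d) ℂ,
      R.1 = 1 - (2 : ℂ) • (registerEmbedding d (0 : Fin (N + 1)) i₀ *
        (registerEmbedding d (0 : Fin (N + 1)) i₀)ᴴ) :=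
    ⟨⟨_, one_sub_two_mul_proj_mem_unitaryGroup hE⟩, rfl⟩
  have hA := ((((hW.mul_const R).mul (hW.conjTranspose (queryGate_conjTranspose N))).mul_const
    R).mul hW).const_mul (-1)
  rw [show 3 * k = k + k + k by ring]
  refine ⟨_, hA, fun Q => ?_⟩
  have := amplification_error hE (hW.mem_unitaryGroup (queryGate_mem_unitaryGroup N) Q)
    (Matrix.mem_unitaryGroup_iff'.1 (hV Q)) (hB Q) hδ (h Q)
  rw [← hR] at this
  rwa [Unitary.coe_neg, OneMemClass.coe_one, Matrix.neg_mul 1, Matrix.one_mul]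

end Combination

/-! ### Fractional powers -/

section FractionalPower

variable {η d : ℕ} {Q : Matrix (Fin d) (Fin d) ℂ}

/-- The eigenvalue `e ^ (-iπα)` of a fractional power. -/
noncomputable def fractionalPhase (α : ℝ) : ℂ := Complex.exp (-Complex.I * Real.pi * α)

theorem fractionalPhase_add (α β : ℝ) :
    fractionalPhase (α + β) = fractionalPhase α * fractionalPhase β := by
  rw [fractionalPhase, fractionalPhase, fractionalPhase, ← Complex.exp_add]
  congr 1
  push_cast
  ring

theorem norm_fractionalPhase (α : ℝ) : ‖fractionalPhase α‖ = 1 := by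
  rw [fractionalPhase, show -Complex.I * Real.pi * α = ((-(Real.pi * α) : ℝ) : ℂ) * Complex.I by
    push_cast; ring, Complex.norm_exp_ofReal_mul_I]

theorem star_fractionalPhase (α : ℝ) : star (fractionalPhase α) = fractionalPhase (-α) := by
  simp [fractionalPhase, ← Complex.exp_conj]

theorem norm_one_add_fractionalPhase_le (α : ℝ) : ‖(1 + fractionalPhase α) / 2‖ ≤ 1 := by
  have h := norm_add_le (1 : ℂ) (fractionalPhase α)
  rw [norm_fractionalPhase, norm_one] at h
  rw [norm_div, Complex.norm_ofNat]
  linarith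

theorem norm_one_sub_fractionalPhase_le {α : ℝ} (hα : 0 ≤ α) :
    ‖(1 - fractionalPhase α) / 2‖ ≤ Real.pi / 2 * α := by
  have h := Real.norm_exp_I_mul_ofReal_sub_one_le (x := -(Real.pi * α))
  rw [show Complex.I * ((-(Real.pi * α) : ℝ) : ℂ) = -Complex.I * Real.pi * α by push_cast; ring,
    norm_neg, Real.norm_of_nonneg (by positivity)] at h
  rw [norm_div, Complex.norm_ofNat, norm_sub_rev]
  change ‖fractionalPhase α - 1‖ ≤ _ at h
  linarith

theorem fractionalPower_eq (Q : Matrix (Fin d) (Fin d) ℂ) (α : ℝ) :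
    fractionalPower Q α =
      ((1 + fractionalPhase α) / 2) • (1 : Matrix (Fin d) (Fin d) ℂ) +
        ((1 - fractionalPhase α) / 2) • Q := by
  rw [fractionalPower, fractionalPhase]
  module

theorem fractionalPower_zero (Q : Matrix (Fin d) (Fin d) ℂ) : fractionalPower Q 0 = 1 := by
  simp [fractionalPower_eq, fractionalPhase]

theorem fractionalPower_mul (hQ : Q * Q = 1) (α β : ℝ) :
    fractionalPower Q α * fractionalPower Q β = fractionalPower Q (α + β) := by
  simp only [fractionalPower_eq, fractionalPhase_add, Matrix.add_mul, Matrix.mul_add,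
    Matrix.smul_mul, Matrix.mul_smul, Matrix.one_mul, Matrix.mul_one, hQ]
  module

theorem fractionalPower_pow (hQ : Q * Q = 1) (α : ℝ) (n : ℕ) :
    fractionalPower Q α ^ n = fractionalPower Q (n * α) := by
  induction n with
  | zero => simp [fractionalPower_zero]
  | succ n ih =>
    rw [pow_succ, ih, fractionalPower_mul hQ]
    congr 1
    push_cast
    ring

theorem fractionalPower_mem_unitaryGroup (hQ : IsSignOracle Q) (α : ℝ) :
    fractionalPower Q α ∈ Matrix.unitaryGroup (Fin d) ℂ := by
  have h : star (fractionalPower Q α) = fractionalPower Q (-α) := by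
    have h2 : star (2 : ℂ) = 2 := by simp
    simp only [fractionalPower_eq, Matrix.star_eq_conjTranspose,
      Matrix.conjTranspose_smul, hQ.conjTranspose_eq, Matrix.conjTranspose_one, star_div₀, star_add,
      star_sub, star_one, star_fractionalPhase, h2]
  rw [Matrix.mem_unitaryGroup_iff, h, fractionalPower_mul hQ.mul_self, add_neg_cancel,
    fractionalPower_zero]

end FractionalPower

/-! ### Sequences of fractional queries -/

section Steps

variable {η d : ℕ}

/-- The operation performed by a list of steps, the last step first. -/
noncomputable def stepsEval (l : List (FractionalStep η d)) (Q : OracleFamily η d) :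
    Matrix (Fin d) (Fin d) ℂ :=
  (l.map fun s => s.gate.1 * fractionalPower (Q.1 s.oracle) s.exponent).prod

/-- The sum of the exponents of a list of steps. -/
noncomputable def stepsCost (l : List (FractionalStep η d)) : ℝ :=
  (l.map FractionalStep.exponent).sum

theorem stepsEval_cons (s : FractionalStep η d) (l : List (FractionalStep η d))
    (Q : OracleFamily η d) : stepsEval (s :: l) Q =
      s.gate.1 * fractionalPower (Q.1 s.oracle) s.exponent * stepsEval l Q := by
  simp [stepsEval]

theorem stepsEval_append (l l' : List (FractionalStep η d)) (Q : OracleFamily η d) :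
    stepsEval (l ++ l') Q = stepsEval l Q * stepsEval l' Q := by
  simp [stepsEval]

theorem stepsCost_cons (s : FractionalStep η d) (l : List (FractionalStep η d)) :
    stepsCost (s :: l) = s.exponent + stepsCost l := by
  simp [stepsCost]

theorem stepsCost_append (l l' : List (FractionalStep η d)) :
    stepsCost (l ++ l') = stepsCost l + stepsCost l' := by
  simp [stepsCost]

theorem stepsCost_nonneg (l : List (FractionalStep η d)) : 0 ≤ stepsCost l :=
  List.sum_nonneg fun x hx => by
    obtain ⟨s, -, rfl⟩ := List.mem_map.1 hx
    exact s.exponent_pos.le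

theorem stepsEval_mem_unitaryGroup (l : List (FractionalStep η d)) (Q : OracleFamily η d) :
    stepsEval l Q ∈ Matrix.unitaryGroup (Fin d) ℂ := by
  induction l with
  | nil => exact one_mem _
  | cons s l ih =>
    rw [stepsEval_cons]
    exact mul_mem (mul_mem s.gate.2 (fractionalPower_mem_unitaryGroup (Q.2 _) _)) ih

theorem FractionalQueryAlgorithm.eval_eq (A : FractionalQueryAlgorithm η d)
    (Q : OracleFamily η d) : A.eval Q.1 = stepsEval A.steps.reverse Q * A.first.1 := by
  rw [FractionalQueryAlgorithm.eval]
  generalize A.first.1 = M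
  induction A.steps generalizing M with
  | nil => simp [stepsEval]
  | cons s l ih =>
    rw [List.foldl_cons, ih, List.reverse_cons, stepsEval_append]
    simp [stepsEval, Matrix.mul_assoc]

/-- The part of `stepsEval l` of degree less than `k` in the oracles, when the fractional powers
are written as linear combinations of `1` and the oracles. -/
noncomputable def truncatedEval :
    ℕ → List (FractionalStep η d) → OracleFamily η d → Matrix (Fin d) (Fin d) ℂ
  | 0, _, _ => 0
  | _ + 1, [], _ => 1
  | k + 1, s :: l, Q => s.gate.1 *
      (((1 + fractionalPhase s.exponent) / 2) • truncatedEval (k + 1) l Q +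
        ((1 - fractionalPhase s.exponent) / 2) • (Q.1 s.oracle * truncatedEval k l Q))

theorem pow_succ_add_le {x y : ℝ} (hx : 0 ≤ x) (hy : 0 ≤ y) (k : ℕ) :
    x ^ (k + 1) + (k + 1) * (y * x ^ k) ≤ (x + y) ^ (k + 1) := by
  induction k with
  | zero => simp
  | succ k ih =>
    have h := mul_le_mul_of_nonneg_right ih (add_nonneg hx hy)
    rw [pow_succ (x + y)]
    refine le_trans ?_ h
    push_cast
    have : 0 ≤ (k + 1) * (y ^ 2 * x ^ k) := by positivity
    rw [pow_succ x (k + 1), pow_succ x k]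
    nlinarith

theorem norm_stepsEval_sub_truncatedEval_le (k : ℕ) (l : List (FractionalStep η d))
    (Q : OracleFamily η d) :
    ‖stepsEval l Q - truncatedEval k l Q‖ ≤
      (Real.pi / 2 * stepsCost l) ^ k / k.factorial := by
  induction l generalizing k with
  | nil =>
    cases k with
    | zero =>
      simpa [truncatedEval] using l2_opNorm_le_one_of_unitary (stepsEval_mem_unitaryGroup [] Q)
    | succ k => simp [truncatedEval, stepsEval, stepsCost]
  | cons s l ih =>
    cases k with
    | zero =>
      simpa [truncatedEval] using l2_opNorm_le_one_of_unitary (stepsEval_mem_unitaryGroup _ Q)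
    | succ k =>
      have e : stepsEval (s :: l) Q - truncatedEval (k + 1) (s :: l) Q = s.gate.1 *
          (((1 + fractionalPhase s.exponent) / 2) •
              (stepsEval l Q - truncatedEval (k + 1) l Q) +
            ((1 - fractionalPhase s.exponent) / 2) •
              (Q.1 s.oracle * (stepsEval l Q - truncatedEval k l Q))) := by
        rw [stepsEval_cons, truncatedEval, fractionalPower_eq, Matrix.mul_assoc, ← Matrix.mul_sub]
        congr 1
        rw [Matrix.add_mul, Matrix.smul_mul, Matrix.smul_mul, Matrix.one_mul, Matrix.mul_sub]
        module
      have hx : 0 ≤ Real.pi / 2 * stepsCost l :=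
        mul_nonneg (by positivity) (stepsCost_nonneg l)
      have hy : 0 ≤ Real.pi / 2 * s.exponent := mul_nonneg (by positivity) s.exponent_pos.le
      have e1 : ‖((1 + fractionalPhase s.exponent) / 2) •
          (stepsEval l Q - truncatedEval (k + 1) l Q)‖ ≤
          (Real.pi / 2 * stepsCost l) ^ (k + 1) / (k + 1).factorial := by
        rw [norm_smul]
        exact (mul_le_of_le_one_left (norm_nonneg _) (norm_one_add_fractionalPhase_le _)).trans
          (ih _)
      have e2 : ‖((1 - fractionalPhase s.exponent) / 2) •
          (Q.1 s.oracle * (stepsEval l Q - truncatedEval k l Q))‖ ≤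
          Real.pi / 2 * s.exponent * ((Real.pi / 2 * stepsCost l) ^ k / k.factorial) := by
        rw [norm_smul]
        exact mul_le_mul (norm_one_sub_fractionalPhase_le s.exponent_pos.le)
          ((l2_opNorm_mul_le_of_left (l2_opNorm_le_one_of_unitary (Q.2 _).1)).trans (ih _))
          (norm_nonneg _) hy
      rw [e]
      refine (l2_opNorm_mul_le_of_left (l2_opNorm_le_one_of_unitary s.gate.2)).trans
        ((norm_add_le _ _).trans ((add_le_add e1 e2).trans ?_))
      rw [stepsCost_cons, mul_add, add_comm (Real.pi / 2 * s.exponent)]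
      set x := Real.pi / 2 * stepsCost l
      set y := Real.pi / 2 * s.exponent
      have hk : (0 : ℝ) < k.factorial := by exact_mod_cast k.factorial_pos
      have h := pow_succ_add_le hx hy k
      rw [Nat.factorial_succ]
      push_cast
      rw [le_div_iff₀ (by positivity)]
      refine le_trans (le_of_eq ?_) h
      field_simp

theorem isQueryCombination_truncatedEval (i₀ : Fin η) (k : ℕ) (l : List (FractionalStep η d)) :
    IsQueryCombination i₀ k (Real.exp (Real.pi / 2 * stepsCost l)) (truncatedEval k l) := by
  induction l generalizing k with
  | nil =>
    cases k with
    | zero =>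
      refine IsQueryCombination.mono (Real.exp_nonneg _) ?_
      simpa only [truncatedEval] using IsQueryCombination.zero
    | succ k =>
      refine IsQueryCombination.mono (s := 1) (by simp [stepsCost]) ?_
      exact IsQueryCombination.of_targetComputable (.one _)
  | cons s l ih =>
    cases k with
    | zero =>
      refine IsQueryCombination.mono (Real.exp_nonneg _) ?_
      exact IsQueryCombination.zero
    | succ k =>
      have h := (((ih (k + 1)).smul ((1 + fractionalPhase s.exponent) / 2)).add
        (((ih k).oracle_mul s.oracle).smul ((1 - fractionalPhase s.exponent) / 2))).gate_mul s.gate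
      refine IsQueryCombination.mono ?_ h
      rw [← add_mul, stepsCost_cons, mul_add, Real.exp_add]
      refine mul_le_mul_of_nonneg_right ?_ (Real.exp_nonneg _)
      have h1 := norm_one_add_fractionalPhase_le s.exponent
      have h2 := norm_one_sub_fractionalPhase_le s.exponent_pos.le
      have h3 := Real.add_one_le_exp (Real.pi / 2 * s.exponent)
      linarith

theorem exists_isSimulable_of_cost_le (i₀ : Fin η) (k : ℕ) {l : List (FractionalStep η d)}
    (hl : stepsCost l ≤ 1 / 4) :
    ∃ N₀ : ℕ, ∀ N ≥ N₀, IsSimulable i₀ N (3 * k) (stepsEval l) (4 / k.factorial) := by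
  have hx : 0 ≤ Real.pi / 2 * stepsCost l := mul_nonneg (by positivity) (stepsCost_nonneg l)
  have hx1 : Real.pi / 2 * stepsCost l ≤ 1 / 2 := by
    nlinarith [Real.pi_lt_four, Real.pi_pos, stepsCost_nonneg l]
  have hexp : Real.exp (Real.pi / 2 * stepsCost l) ≤ 2 := by
    refine (Real.exp_le_exp.2 (hx1.trans ?_)).trans_eq (Real.exp_log two_pos)
    linarith [Real.log_two_gt_d9]
  have hk : (1 : ℝ) ≤ k.factorial := by exact_mod_cast k.factorial_pos
  have h := ((isQueryCombination_truncatedEval i₀ k l).mono hexp).exists_isSimulable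
    (stepsEval_mem_unitaryGroup l) (δ := 1 / k.factorial) ((div_le_one (by linarith)).2 hk)
    (fun Q => (norm_stepsEval_sub_truncatedEval_le k l Q).trans
      (div_le_div_of_nonneg_right (pow_le_one₀ hx (hx1.trans (by norm_num))) (by linarith)))
  rwa [mul_one_div] at h

/-- A list of short steps is cut into segments whose cost is between `1 / 8` and `1 / 4`. -/
theorem exists_segments (i₀ : Fin η) (k : ℕ) (l : List (FractionalStep η d))
    (hl : ∀ s ∈ l, s.exponent ≤ 1 / 8) :
    ∃ (h l' : List (FractionalStep η d)) (n : ℕ), l = h ++ l' ∧ stepsCost h ≤ 1 / 8 ∧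
      n / 8 + stepsCost h ≤ stepsCost l ∧ ∃ N₀ : ℕ, ∀ N ≥ N₀,
        IsSimulable i₀ N (n * (3 * k)) (stepsEval l') (n * (4 / k.factorial)) := by
  induction l with
  | nil =>
    refine ⟨[], [], 0, rfl, by simp [stepsCost], by simp, 0, fun N _ => ?_⟩
    rw [Nat.zero_mul, Nat.cast_zero, zero_mul]
    exact .of_gate 1
  | cons s l ih =>
    obtain ⟨h, l', n, rfl, h1, h2, N₀, hN₀⟩ := ih fun t ht => hl t (List.mem_cons_of_mem _ ht)
    have hs := hl s List.mem_cons_self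
    by_cases hc : stepsCost (s :: h) ≤ 1 / 8
    · refine ⟨s :: h, l', n, rfl, hc, ?_, N₀, hN₀⟩
      simp only [stepsCost_cons] at *
      linarith
    · obtain ⟨N₁, hN₁⟩ := exists_isSimulable_of_cost_le i₀ k (l := s :: h) (by
        rw [stepsCost_cons]; linarith)
      refine ⟨[], s :: h ++ l', n + 1, rfl, by simp [stepsCost], ?_, max N₀ N₁, fun N hN => ?_⟩
      · rw [stepsCost_cons s (h ++ l')]
        rw [stepsCost_cons] at hc
        push_cast
        simp only [stepsCost_append] at *
        simp only [stepsCost, List.map_nil, List.sum_nil] at *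
        linarith
      · have := (hN₁ N (le_of_max_le_right hN)).mul (hN₀ N (le_of_max_le_left hN))
          (stepsEval_mem_unitaryGroup l')
        convert this using 1
        · ring
        · funext Q
          exact stepsEval_append _ _ Q
        · push_cast
          ring

theorem exists_isSimulable_of_exponent_le (i₀ : Fin η) (k : ℕ) (l : List (FractionalStep η d))
    (hl : ∀ s ∈ l, s.exponent ≤ 1 / 8) :
    ∃ n : ℕ, n ≤ 8 * stepsCost l + 1 ∧ ∃ N : ℕ,
      IsSimulable i₀ N (n * (3 * k)) (stepsEval l) (n * (4 / k.factorial)) := by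
  obtain ⟨h, l', n, rfl, h1, h2, N₀, hN₀⟩ := exists_segments i₀ k l hl
  obtain ⟨N₁, hN₁⟩ := exists_isSimulable_of_cost_le i₀ k (l := h) (by linarith)
  refine ⟨n + 1, ?_, max N₀ N₁, ?_⟩
  · push_cast
    linarith [stepsCost_nonneg h]
  · have := (hN₁ _ (le_max_right N₀ N₁)).mul (hN₀ _ (le_max_left N₀ N₁))
      (stepsEval_mem_unitaryGroup l')
    convert this using 1
    · ring
    · funext Q
      exact stepsEval_append _ _ Q
    · push_cast
      ring

/-- The step `s` with its exponent divided by `8` and its gate replaced by `U`. -/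
noncomputable def FractionalStep.eighth (s : FractionalStep η d)
    (U : Matrix.unitaryGroup (Fin d) ℂ) : FractionalStep η d where
  exponent := s.exponent / 8
  exponent_pos := div_pos s.exponent_pos (by norm_num)
  exponent_le_one := by linarith [s.exponent_le_one]
  oracle := s.oracle
  gate := U

/-- Every step replaced by eight steps with an eighth of its exponent. -/
noncomputable def splitSteps (l : List (FractionalStep η d)) : List (FractionalStep η d) :=
  l.flatMap fun s => s.eighth s.gate :: List.replicate 7 (s.eighth 1)

theorem exponent_le_of_mem_splitSteps {l : List (FractionalStep η d)} {s : FractionalStep η d}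
    (hs : s ∈ splitSteps l) : s.exponent ≤ 1 / 8 := by
  obtain ⟨t, -, ht⟩ := List.mem_flatMap.1 hs
  have h : s.exponent = t.exponent / 8 := by
    rcases List.mem_cons.1 ht with rfl | ht
    · rfl
    · rw [List.eq_of_mem_replicate ht]
      rfl
  linarith [t.exponent_le_one]

theorem stepsCost_splitSteps (l : List (FractionalStep η d)) :
    stepsCost (splitSteps l) = stepsCost l := by
  induction l with
  | nil => rfl
  | cons s l ih =>
    rw [splitSteps, List.flatMap_cons, stepsCost_append, ← splitSteps, ih, stepsCost_cons s l]
    simp [stepsCost, FractionalStep.eighth]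
    ring

theorem stepsEval_splitSteps (l : List (FractionalStep η d)) (Q : OracleFamily η d) :
    stepsEval (splitSteps l) Q = stepsEval l Q := by
  induction l with
  | nil => rfl
  | cons s l ih =>
    rw [splitSteps, List.flatMap_cons, stepsEval_append, ← splitSteps, ih, stepsEval_cons s l]
    congr 1
    rw [stepsEval_cons]
    simp only [stepsEval, FractionalStep.eighth, List.map_replicate, List.prod_replicate,
      OneMemClass.coe_one, Matrix.one_mul]
    have hQ := (Q.2 s.oracle).mul_self
    rw [fractionalPower_pow hQ, Matrix.mul_assoc, fractionalPower_mul hQ]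
    congr 2
    push_cast
    ring

end Steps

/-! ### The number of queries -/

theorem exists_factorial_ge {y : ℝ} (hy : Real.exp 1 < y) :
    ∃ k : ℕ, (k : ℝ) ≤ 11 * (Real.log y / Real.log (Real.log y)) ∧ 36 * y ≤ k.factorial := by
  have hy0 : 0 < y := (Real.exp_pos 1).trans hy
  set L := Real.log y with hL
  have hL1 : 1 < L := by rwa [hL, Real.lt_log_iff_exp_lt hy0]
  set ℓ := Real.log L with hℓ
  have hℓ0 : 0 < ℓ := Real.log_pos hL1
  have hLexp : L = Real.exp (ℓ / 2) * Real.exp (ℓ / 2) := by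
    rw [← Real.exp_add, add_halves, hℓ, Real.exp_log (by linarith)]
  have hhalf : Real.exp 1 * (ℓ / 2) ≤ Real.exp (ℓ / 2) := by
    have h := Real.add_one_le_exp (ℓ / 2 - 1)
    rw [sub_add_cancel, Real.exp_sub, le_div_iff₀ (Real.exp_pos 1)] at h
    linarith
  have he : (2 : ℝ) < Real.exp 1 := by linarith [Real.exp_one_gt_d9]
  have hratio : Real.exp 1 / 2 * Real.exp (ℓ / 2) ≤ L / ℓ := by
    rw [le_div_iff₀ hℓ0]
    calc Real.exp 1 / 2 * Real.exp (ℓ / 2) * ℓ = Real.exp (ℓ / 2) * (Real.exp 1 * (ℓ / 2)) := by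
          ring
      _ ≤ Real.exp (ℓ / 2) * Real.exp (ℓ / 2) :=
          mul_le_mul_of_nonneg_left hhalf (Real.exp_nonneg _)
      _ = L := hLexp.symm
  have hratio1 : 1 ≤ L / ℓ := by
    refine le_trans ?_ hratio
    nlinarith [Real.one_le_exp (show 0 ≤ ℓ / 2 by linarith)]
  refine ⟨⌈10 * (L / ℓ)⌉₊, ?_, ?_⟩
  · have := Nat.ceil_lt_add_one (show 0 ≤ 10 * (L / ℓ) by linarith)
    linarith
  · set k := ⌈10 * (L / ℓ)⌉₊
    have hk : 10 * (L / ℓ) ≤ k := Nat.le_ceil _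
    have hk0 : (0 : ℝ) < k := by linarith
    have hkexp : Real.exp (1 + ℓ / 2) ≤ k := by
      rw [Real.exp_add]
      nlinarith [mul_pos (Real.exp_pos 1) (Real.exp_pos (ℓ / 2))]
    have hkL : L * 5 ≤ k * (ℓ / 2) := by
      have h := mul_le_mul_of_nonneg_right hk hℓ0.le
      have h' : 10 * (L / ℓ) * ℓ = 10 * L := by field_simp
      linarith
    have hpow : Real.exp (k * (1 + ℓ / 2)) ≤ (k : ℝ) ^ k := by
      rw [Real.exp_nat_mul]
      exact pow_le_pow_left₀ (Real.exp_nonneg _) hkexp k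
    have hfac := Real.pow_div_factorial_le_exp (k : ℝ) hk0.le k
    rw [div_le_iff₀ (by exact_mod_cast k.factorial_pos)] at hfac
    have h1 : Real.exp (k * (ℓ / 2)) ≤ k.factorial := by
      have h := hpow.trans hfac
      rw [mul_add, mul_one, Real.exp_add] at h
      exact le_of_mul_le_mul_left h (Real.exp_pos _)
    have h36 : (36 : ℝ) ≤ Real.exp (4 * L) := by
      have h : (2.7 : ℝ) ^ 4 ≤ Real.exp 1 ^ 4 :=
        pow_le_pow_left₀ (by norm_num) (by linarith [Real.exp_one_gt_d9]) 4
      rw [← Real.exp_nat_mul] at h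
      refine (show (36 : ℝ) ≤ 2.7 ^ 4 by norm_num).trans (h.trans (Real.exp_le_exp.2 ?_))
      push_cast
      linarith
    calc 36 * y ≤ Real.exp (4 * L) * Real.exp L := by
          rw [hL, Real.exp_log hy0, ← hL]
          exact mul_le_mul_of_nonneg_right h36 hy0.le
      _ = Real.exp (L * 5) := by rw [← Real.exp_add]; ring_nf
      _ ≤ Real.exp (k * (ℓ / 2)) := Real.exp_le_exp.2 hkL
      _ ≤ k.factorial := h1

/-! ### The main theorem -/

theorem IsSimulable.exists_circuit {η d N k : ℕ} {i₀ : Fin η}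
    {V : OracleFamily η d → Matrix (Fin d) (Fin d) ℂ} {δ : ℝ} (hV : IsSimulable i₀ N k V δ) :
    ∃ C : QueryCircuit η d, C.queries = k ∧
      ∀ Q : OracleFamily η d, C.Implements Q.1 (V Q) δ := by
  obtain ⟨A, hA, h⟩ := hV
  obtain ⟨U, l, hl, hU⟩ := hA.exists_list
  refine ⟨⟨Fin (N + 1), 0, 0, i₀, U, l⟩, hl, fun Q ψ hψ => ?_⟩
  set C : QueryCircuit η d := ⟨Fin (N + 1), 0, 0, i₀, U, l⟩
  have hemb : ∀ φ : Fin d → ℂ, C.embed φ = registerEmbedding d (0 : Fin (N + 1)) i₀ *ᵥ φ := by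
    intro φ
    ext ⟨(w : Fin (N + 1)), c, i, x⟩
    change (if w = 0 ∧ c = 0 ∧ i = i₀ then φ x else 0) = _
    simp only [registerEmbedding, workEmbedding, targetEmbedding,
      Matrix.mulVec, dotProduct, Pi.single_apply, Prod.mk.injEq]
    by_cases hw : w = 0 <;> by_cases hc : c = 0 <;> by_cases hi : i = i₀ <;> simp [hw, hc, hi]
  have heval : C.eval Q.1 = A Q := hU Q
  rw [hemb, hemb, heval, Matrix.mulVec_mulVec, Matrix.mulVec_mulVec, ← Matrix.sub_mulVec]
  refine (Matrix.l2_opNorm_mulVec _ (WithLp.toLp 2 ψ)).trans ?_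
  rw [hψ, mul_one]
  exact h Q

theorem mainTheorem7 :
    ∃ K : ℝ, 0 < K ∧
      ∀ (η d : ℕ) (A : FractionalQueryAlgorithm η d) (T ε : ℝ),
        A.cost = T → 1 ≤ T → 0 < ε → Real.exp 1 < T / ε →
        ∃ C : QueryCircuit η d,
          (C.queries : ℝ) ≤ K * (T * (Real.log (T / ε) / Real.log (Real.log (T / ε)))) ∧
          ∀ Q : Fin η → Matrix (Fin d) (Fin d) ℂ, (∀ j, IsSignOracle (Q j)) →
            C.Implements Q (A.eval Q) ε := by
  refine ⟨297, by norm_num, fun η d A T ε hA hT hε hTε => ?_⟩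
  have hcost : stepsCost A.steps.reverse = T := by
    rw [← hA, stepsCost, List.map_reverse, List.sum_reverse]
    rfl
  obtain ⟨i₀⟩ : Nonempty (Fin η) := by
    rcases hs : A.steps with _ | ⟨s, l⟩
    · rw [hs] at hcost
      norm_num [stepsCost] at hcost
      linarith
    · exact ⟨s.oracle⟩
  obtain ⟨k, hk, hfac⟩ := exists_factorial_ge hTε
  obtain ⟨n, hn, N, hN⟩ := exists_isSimulable_of_exponent_le i₀ k (splitSteps A.steps.reverse)
    fun s hs => exponent_le_of_mem_splitSteps hs
  rw [stepsCost_splitSteps, hcost] at hn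
  obtain ⟨C, hC, hI⟩ := (hN.mul (.of_gate A.first) fun _ => A.first.2).exists_circuit
  have hn9 : (n : ℝ) ≤ 9 * T := by linarith
  refine ⟨C, ?_, fun Q hQ ψ hψ => ?_⟩
  · rw [hC]
    push_cast
    have h := mul_le_mul hn9 hk (Nat.cast_nonneg k) (by linarith)
    linarith
  · have h := hI ⟨Q, hQ⟩ ψ hψ
    rw [stepsEval_splitSteps, ← FractionalQueryAlgorithm.eval_eq] at h
    refine h.trans ?_
    have hf : (0 : ℝ) < k.factorial := by exact_mod_cast k.factorial_pos
    rw [add_zero, mul_div_assoc', div_le_iff₀ hf]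
    rw [mul_div_assoc', div_le_iff₀ hε] at hfac
    linarith
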